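/- Let $n\ge 1$. Equip $\mathbb C^{n+1}$ with the Hermitian form of signature $(n,1)$ $$\langle Z,W\rangle = Z_0\overline{W_n}+\sum_{i=1}^{n-1}Z_i\overline{W_i}+Z_n\overline{W_0},$$ let $\mathbf H^n_{\mathbb C}\subset\mathbb P(\mathbb C^{n+1})$ be complex hyperbolic space (the set of negative lines) and $S^{2n-1}=\partial\mathbf H^n_{\mathbb C}$ the set of isotropic lines. Let $\Gamma$ be a discrete subgroup of $\mathrm{PU}(n,1)$, let $\Lambda\subset S^{2n-1}$ be its limit set (the set of accumulation points in $S^{2n-1}$ of the $\Gamma$-orbit of a point of $\mathbf H^n_{\mathbb C}$), and let $\Omega=S^{2n-1}\setminus\Lambda$. Identify each $p\in\Lambda$ with the class $\phi_p$ of the linear form $\langle\cdot,\mathbf p\rangle$, whose kernel is the complex hyperplane tangent to the sphere at $p$. For hyperplanes $\phi,\phi'$ (classes of linear forms) and distinct points $\omega,\omega'$ of $\mathbb P(\mathbb C^{n+1})$ not on these hyperplanes, let $[\phi,\phi',\omega,\omega']$ be the cross-ratio $[a,b,\omega,\omega']$ on the projective line $(\omega\omega')$, where $a=\ker\phi\cap(\omega\omega')$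 and $b=\ker\phi'\cap(\omega\omega')$, with the convention $[a,b,c,d]=\frac{(d-b)(c-a)}{(d-a)(c-b)}$; put $[\phi,\phi',\omega,\omega]=1$. (In terms of lifts it equals $\frac{\boldsymbol\phi(\boldsymbol\omega)\boldsymbol\phi'(\boldsymbol\omega')}{\boldsymbol\phi(\boldsymbol\omega')\boldsymbol\phi'(\boldsymbol\omega)}$.) For $\omega,\omega'\in\Omega$ set $$d_\Lambda(\omega,\omega')=\ln\Bigl(\max\bigl\{\,\bigl|[\phi_p,\phi_{p'},\omega,\omega']\bigr| : p,p'\in\Lambda\bigr\}\Bigr).$$ For distinct $p_0,p_1\in\mathbf H^n_{\mathbb C}$ with lifts $v_0,v_1$ such that $\langle v_0,v_0\rangle=\langle v_1,v_1\rangle$, the bisector of $p_0,p_1$, extended to the boundary, is the set of $z\in\mathbf H^n_{\mathbb C}\cup S^{2n-1}$ with $|\langle \mathbf z,v_0\rangle|=|\langle \mathbf z,v_1\rangle|$; its intersection with $S^{2n-1}$ is a spinal sphere. Corollary. If $\Lambda$ is not contained in any bisector (equivalently, in any spinal sphere), then the maximum defining $d_\Lambda(\omega,\omega')$ exists for all $\omega,\omega'\in\Omega$,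 and $d_\Lambda$ is a metric on $\Omega$. -/

import Mathlib

open scoped LinearAlgebra.Projectivization MatrixGroups
open Module (Dual)

namespace GenHilbert

noncomputable section

/-! ### Cross-ratios and the generalized Hilbert metric -/

section CrossRatio

variable {V : Type*} [AddCommGroup V] [Module ℂ V]

/-- The determinant of two vectors of `ℂ²`. -/
def det₂ (u v : Fin 2 → ℂ) : ℂ := u 0 * v 1 - u 1 * v 0

/-- `t` is the cross-ratio `[a, b, c, d] = (d - b)(c - a) / ((d - a)(c - b))` of four points of a
projective line of `ℙ(V)`, computed in some coordinate on that line. The coordinate is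
`z = g₀ / g₁`, where `g = (g₀, g₁) : V → ℂ²` is injective on the plane spanned by the four points,
and the difference `x - y` of the coordinates of two points is written homogeneously as
`det₂ (g x) (g y)` (so that a point may be at infinity). -/
def IsLineCrossRatio (a b c d : ℙ ℂ V) (t : ℂ) : Prop :=
  ∃ g : V →ₗ[ℂ] (Fin 2 → ℂ),
    (∀ v ∈ a.submodule ⊔ b.submodule ⊔ c.submodule ⊔ d.submodule, g v = 0 → v = 0) ∧
    t = (det₂ (g d.rep) (g b.rep) * det₂ (g c.rep) (g a.rep)) /
        (det₂ (g d.rep) (g a.rep) * det₂ (g c.rep) (g b.rep))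

/-- The cross-ratio `[a, b, c, d]` of four points of a projective line of `ℙ(V)`. -/
def lineCrossRatio (a b c d : ℙ ℂ V) : ℂ :=
  Classical.epsilon (IsLineCrossRatio a b c d)

/-- The intersection point `φ_{ω, ω'}` of the hyperplane `ker φ` with the projective line spanned by
the distinct points `ω` and `ω'`. -/
def lineKer (φ : ℙ ℂ (Dual ℂ V)) (ω ω' : ℙ ℂ V) : ℙ ℂ V :=
  @Classical.epsilon _ ⟨ω⟩ fun x : ℙ ℂ V =>
    x.submodule ≤ LinearMap.ker φ.rep ⊓ (ω.submodule ⊔ ω'.submodule)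

open Classical in
/-- The cross-ratio `[φ, φ', ω, ω'] = [φ_{ω, ω'}, φ'_{ω, ω'}, ω, ω']` of two hyperplanes and two
points, with the value `1` when the two points coincide. See `crossRatio_mk` for its expression
`φ(ω) φ'(ω') / (φ(ω') φ'(ω))` through lifts. -/
def crossRatio (φ φ' : ℙ ℂ (Dual ℂ V)) (ω ω' : ℙ ℂ V) : ℂ :=
  if ω = ω' then 1 else lineCrossRatio (lineKer φ ω ω') (lineKer φ' ω ω') ω ω'

/-- The moduli of all the cross-ratios `[φ, φ', ω, ω']`, for `φ` and `φ'` in `Λ`. -/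
def crossRatioModuli (Λ : Set (ℙ ℂ (Dual ℂ V))) (ω ω' : ℙ ℂ V) : Set ℝ :=
  {r | ∃ φ ∈ Λ, ∃ φ' ∈ Λ, r = ‖crossRatio φ φ' ω ω'‖}

/-- The generalized Hilbert (pseudo-)metric
`d_Λ(ω, ω') = ln (max {|[φ, φ', ω, ω']| : φ, φ' ∈ Λ})`. -/
def hilbertDist (Λ : Set (ℙ ℂ (Dual ℂ V))) (ω ω' : ℙ ℂ V) : ℝ :=
  Real.log (sSup (crossRatioModuli Λ ω ω'))

lemma lineKer_spec (φ : ℙ ℂ (Dual ℂ V)) {ω ω' : ℙ ℂ V} (h : ω ≠ ω')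
    (h1 : φ.rep ω.rep ≠ 0) :
    ∃ k : ℂ, k ≠ 0 ∧ (lineKer φ ω ω').rep =
      k • (φ.rep ω'.rep • ω.rep - φ.rep ω.rep • ω'.rep) := by
  have hli : LinearIndependent ℂ ![ω.rep, ω'.rep] :=
    Projectivization.linearIndependent_pair_iff_ne.2 h
  rw [LinearIndependent.pair_iff] at hli
  have hne : φ.rep ω'.rep • ω.rep - φ.rep ω.rep • ω'.rep ≠ 0 := by
    intro h0
    have := hli (φ.rep ω'.rep) (-φ.rep ω.rep) (by rw [← h0]; module)
    exact h1 (by simpa using this.2)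
  have hex : ∃ x : ℙ ℂ V,
      x.submodule ≤ LinearMap.ker φ.rep ⊓ (ω.submodule ⊔ ω'.submodule) := by
    refine ⟨Projectivization.mk ℂ _ hne, ?_⟩
    rw [Projectivization.submodule_mk, Submodule.span_singleton_le_iff_mem, Submodule.mem_inf]
    refine ⟨?_, ?_⟩
    · simp [mul_comm]
    · rw [Projectivization.submodule_eq, Projectivization.submodule_eq]
      exact Submodule.sub_mem _
        (Submodule.mem_sup_left (Submodule.smul_mem _ _ (Submodule.mem_span_singleton_self _)))
        (Submodule.mem_sup_right (Submodule.smul_mem _ _ (Submodule.mem_span_singleton_self _)))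
  have hs := @Classical.epsilon_spec_aux _ ⟨ω⟩ _ hex
  change (lineKer φ ω ω').submodule ≤ _ at hs
  rw [Projectivization.submodule_eq, Submodule.span_singleton_le_iff_mem, Submodule.mem_inf,
    Projectivization.submodule_eq, Projectivization.submodule_eq] at hs
  obtain ⟨hk, hm⟩ := hs
  obtain ⟨y, hy, z, hz, hyz⟩ := Submodule.mem_sup.1 hm
  obtain ⟨s, rfl⟩ := Submodule.mem_span_singleton.1 hy
  obtain ⟨t, rfl⟩ := Submodule.mem_span_singleton.1 hz
  have hst : s * φ.rep ω.rep + t * φ.rep ω'.rep = 0 := by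
    have : φ.rep (lineKer φ ω ω').rep = 0 := hk
    rw [← hyz] at this
    simpa using this
  have heq : (lineKer φ ω ω').rep =
      (-t / φ.rep ω.rep) • (φ.rep ω'.rep • ω.rep - φ.rep ω.rep • ω'.rep) := by
    have hs' : s = (-t / φ.rep ω.rep) * φ.rep ω'.rep := by
      field_simp
      linear_combination hst
    have ht' : t = -((-t / φ.rep ω.rep) * φ.rep ω.rep) := by
      field_simp
    rw [← hyz, smul_sub, smul_smul, smul_smul, ← hs']
    nth_rewrite 1 [ht']
    module
  refine ⟨_, ?_, heq⟩
  intro h0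
  rw [h0, zero_smul] at heq
  exact (lineKer φ ω ω').rep_nonzero heq

lemma crossRatio_rep (φ φ' : ℙ ℂ (Dual ℂ V)) (ω ω' : ℙ ℂ V)
    (h1 : φ.rep ω.rep ≠ 0) (h2 : φ.rep ω'.rep ≠ 0)
    (h3 : φ'.rep ω.rep ≠ 0) (h4 : φ'.rep ω'.rep ≠ 0) :
    crossRatio φ φ' ω ω' =
      (φ.rep ω.rep * φ'.rep ω'.rep) / (φ.rep ω'.rep * φ'.rep ω.rep) := by
  unfold crossRatio
  split_ifs with h
  · subst h
    field_simp
  obtain ⟨k, hk0, hk⟩ := lineKer_spec φ h h1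
  obtain ⟨k', hk0', hk'⟩ := lineKer_spec φ' h h3
  have hli : LinearIndependent ℂ ![ω.rep, ω'.rep] :=
    Projectivization.linearIndependent_pair_iff_ne.2 h
  have hli' := LinearIndependent.pair_iff.1 hli
  -- every admissible coordinate gives the claimed value
  have huniq : ∀ t, IsLineCrossRatio (lineKer φ ω ω') (lineKer φ' ω ω') ω ω' t →
      t = (φ.rep ω.rep * φ'.rep ω'.rep) / (φ.rep ω'.rep * φ'.rep ω.rep) := by
    rintro t ⟨g, hg, rfl⟩
    have hmem : ∀ p q : ℂ, p • ω.rep + q • ω'.rep ∈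
        (lineKer φ ω ω').submodule ⊔ (lineKer φ' ω ω').submodule ⊔ ω.submodule ⊔
          ω'.submodule := by
      intro p q
      rw [Projectivization.submodule_eq ω, Projectivization.submodule_eq ω']
      exact Submodule.add_mem _
        (Submodule.mem_sup_left (Submodule.mem_sup_right
          (Submodule.smul_mem _ _ (Submodule.mem_span_singleton_self _))))
        (Submodule.mem_sup_right (Submodule.smul_mem _ _ (Submodule.mem_span_singleton_self _)))
    have hdet : det₂ (g ω.rep) (g ω'.rep) ≠ 0 := by
      intro h0
      have key : ∀ i : Fin 2, g ω'.rep i = 0 ∧ g ω.rep i = 0 := by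
        intro i
        have hz : (g ω'.rep i) • ω.rep + (-(g ω.rep i)) • ω'.rep = 0 := by
          apply hg _ (hmem _ _)
          funext j
          simp only [det₂] at h0
          simp only [map_add, map_smul, Pi.add_apply, Pi.smul_apply, smul_eq_mul, Pi.zero_apply]
          fin_cases i <;> fin_cases j <;> simp only [Fin.zero_eta, Fin.mk_one]
          · ring
          · linear_combination -h0
          · linear_combination h0
          · ring
        have := hli' _ _ hz
        exact ⟨this.1, by simpa using this.2⟩
      refine ω.rep_nonzero (hg _ (by simpa using hmem 1 0) (funext fun i => (key i).2))
    rw [hk, hk']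
    have e1 : det₂ (g ω'.rep) (g (k' • (φ'.rep ω'.rep • ω.rep - φ'.rep ω.rep • ω'.rep))) =
        -(k' * φ'.rep ω'.rep * det₂ (g ω.rep) (g ω'.rep)) := by
      simp only [det₂, map_sub, map_smul, Pi.sub_apply, Pi.smul_apply, smul_eq_mul]; ring
    have e2 : det₂ (g ω.rep) (g (k • (φ.rep ω'.rep • ω.rep - φ.rep ω.rep • ω'.rep))) =
        -(k * φ.rep ω.rep * det₂ (g ω.rep) (g ω'.rep)) := by
      simp only [det₂, map_sub, map_smul, Pi.sub_apply, Pi.smul_apply, smul_eq_mul]; ring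
    have e3 : det₂ (g ω'.rep) (g (k • (φ.rep ω'.rep • ω.rep - φ.rep ω.rep • ω'.rep))) =
        -(k * φ.rep ω'.rep * det₂ (g ω.rep) (g ω'.rep)) := by
      simp only [det₂, map_sub, map_smul, Pi.sub_apply, Pi.smul_apply, smul_eq_mul]; ring
    have e4 : det₂ (g ω.rep) (g (k' • (φ'.rep ω'.rep • ω.rep - φ'.rep ω.rep • ω'.rep))) =
        -(k' * φ'.rep ω.rep * det₂ (g ω.rep) (g ω'.rep)) := by
      simp only [det₂, map_sub, map_smul, Pi.sub_apply, Pi.smul_apply, smul_eq_mul]; ring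
    rw [e1, e2, e3, e4]
    field_simp
  -- an admissible coordinate exists
  have hex : ∃ t, IsLineCrossRatio (lineKer φ ω ω') (lineKer φ' ω ω') ω ω' t := by
    obtain ⟨g, hg⟩ := LinearMap.exists_leftInverse_of_injective
      (Fintype.linearCombination ℂ ![ω.rep, ω'.rep])
      (LinearMap.ker_eq_bot.2 (hli.fintypeLinearCombination_injective))
    refine ⟨_, g, ?_, rfl⟩
    intro v hv hv0
    have hle : (lineKer φ ω ω').submodule ⊔ (lineKer φ' ω ω').submodule ⊔ ω.submodule ⊔
          ω'.submodule ≤ LinearMap.range (Fintype.linearCombination ℂ ![ω.rep, ω'.rep]) := by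
      have hr : ∀ p q : ℂ, p • ω.rep + q • ω'.rep ∈
          LinearMap.range (Fintype.linearCombination ℂ ![ω.rep, ω'.rep]) := fun p q =>
        ⟨![p, q], by simp [Fintype.linearCombination_apply]⟩
      simp only [sup_le_iff, Projectivization.submodule_eq, Submodule.span_singleton_le_iff_mem]
      refine ⟨⟨⟨?_, ?_⟩, by simpa using hr 1 0⟩, by simpa using hr 0 1⟩
      · rw [hk]
        convert hr (k * φ.rep ω'.rep) (-(k * φ.rep ω.rep)) using 1
        module
      · rw [hk']
        convert hr (k' * φ'.rep ω'.rep) (-(k' * φ'.rep ω.rep)) using 1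
        module
    obtain ⟨u, rfl⟩ := hle hv
    have hu : g (Fintype.linearCombination ℂ ![ω.rep, ω'.rep] u) = u :=
      LinearMap.congr_fun hg u
    rw [hu] at hv0
    rw [hv0, map_zero]
  exact huniq _ (Classical.epsilon_spec hex)

/-- The cross-ratio in terms of lifts. -/
theorem crossRatio_mk (f f' : Dual ℂ V) (v v' : V) (hf : f ≠ 0) (hf' : f' ≠ 0)
    (hv : v ≠ 0) (hv' : v' ≠ 0)
    (h1 : f v ≠ 0) (h2 : f v' ≠ 0) (h3 : f' v ≠ 0) (h4 : f' v' ≠ 0) :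
    crossRatio (Projectivization.mk ℂ f hf) (Projectivization.mk ℂ f' hf')
      (Projectivization.mk ℂ v hv) (Projectivization.mk ℂ v' hv') =
      (f v * f' v') / (f v' * f' v) := by
  obtain ⟨a, ha⟩ := Projectivization.exists_smul_eq_mk_rep ℂ f hf
  obtain ⟨a', ha'⟩ := Projectivization.exists_smul_eq_mk_rep ℂ f' hf'
  obtain ⟨b, hb⟩ := Projectivization.exists_smul_eq_mk_rep ℂ v hv
  obtain ⟨b', hb'⟩ := Projectivization.exists_smul_eq_mk_rep ℂ v' hv'
  have ha0 := a.ne_zero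
  have ha0' := a'.ne_zero
  have hb0 := b.ne_zero
  have hb0' := b'.ne_zero
  rw [crossRatio_rep] <;>
    simp only [← ha, ← ha', ← hb, ← hb', Units.smul_def, LinearMap.smul_apply, map_smul,
      smul_eq_mul]
  · field_simp
  all_goals positivity

end CrossRatio

/-! ### Topology on projective spaces and on the projective linear group -/

/-- The quotient topology on the projective space of a topological vector space. -/
instance instTopologicalSpaceProjectivization {V : Type*} [AddCommGroup V] [Module ℂ V]
    [TopologicalSpace V] : TopologicalSpace (ℙ ℂ V) :=
  TopologicalSpace.coinduced (Projectivization.mk' ℂ (V := V)) inferInstance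

/-- The quotient topology on the projective linear group `PGL(m, ℂ)`. -/
instance instTopologicalSpacePGL (m : ℕ) : TopologicalSpace PGL(Fin m, ℂ) :=
  TopologicalSpace.coinduced (Matrix.ProjGenLinGroup.mk (n := Fin m) (R := ℂ)) inferInstance

/-! ### Complex hyperbolic geometry -/

/-- The Hermitian form `⟨Z, W⟩ = Z₀ W̄ₙ + Z₁ W̄₁ + ⋯ + Zₙ₋₁ W̄ₙ₋₁ + Zₙ W̄₀` on `ℂⁿ⁺¹`, of signature
`(n, 1)` for `n ≥ 1`. It is linear in `Z` and conjugate-linear in `W`. -/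
def herm {n : ℕ} (Z W : Fin (n + 1) → ℂ) : ℂ :=
  ∑ i, Z i * star (W (Equiv.swap 0 (Fin.last n) i))

/-- The linear form `⟨·, W⟩`. -/
def hermForm {n : ℕ} (W : Fin (n + 1) → ℂ) : Dual ℂ (Fin (n + 1) → ℂ) where
  toFun Z := herm Z W
  map_add' Z Z' := by simp [herm, add_mul, Finset.sum_add_distrib]
  map_smul' c Z := by simp [herm, mul_assoc, Finset.mul_sum]

lemma hermForm_ne_zero {n : ℕ} {W : Fin (n + 1) → ℂ} (hW : W ≠ 0) : hermForm W ≠ 0 := by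
  intro h
  apply hW
  funext j
  have := LinearMap.congr_fun h (Pi.single (Equiv.swap 0 (Fin.last n) j) 1)
  simpa [hermForm, herm, Pi.single_apply] using this

/-- Complex hyperbolic space `H^n_ℂ`: the set of negative lines. -/
def hypSpace (n : ℕ) : Set (ℙ ℂ (Fin (n + 1) → ℂ)) := {p | (herm p.rep p.rep).re < 0}

/-- The sphere at infinity `S^{2n-1} = ∂H^n_ℂ`: the set of isotropic lines. -/
def sphere (n : ℕ) : Set (ℙ ℂ (Fin (n + 1) → ℂ)) := {p | herm p.rep p.rep = 0}

/-- The point of the dual projective space defined by the linear form `⟨·, p⟩`. When `p` is in the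
sphere at infinity, its kernel is the complex hyperplane tangent to the sphere at `p`. -/
def polar {n : ℕ} (p : ℙ ℂ (Fin (n + 1) → ℂ)) : ℙ ℂ (Dual ℂ (Fin (n + 1) → ℂ)) :=
  Projectivization.mk ℂ (hermForm p.rep) (hermForm_ne_zero p.rep_nonzero)

/-- The bisector of two points `p₀, p₁` of complex hyperbolic space, extended to the sphere at
infinity: the points `z` with `|⟨z, v₀⟩| = |⟨z, v₁⟩|`, where `v₀, v₁` are lifts of `p₀, p₁` such that
`⟨v₀, v₀⟩ = ⟨v₁, v₁⟩`. Inside `H^n_ℂ` these are the points equidistant from `p₀` and `p₁`; the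
points on the sphere at infinity form the corresponding spinal sphere. -/
def bisector {n : ℕ} (p₀ p₁ : ℙ ℂ (Fin (n + 1) → ℂ)) : Set (ℙ ℂ (Fin (n + 1) → ℂ)) :=
  {z | z ∈ hypSpace n ∪ sphere n ∧
    ∃ (v₀ v₁ : Fin (n + 1) → ℂ) (h₀ : v₀ ≠ 0) (h₁ : v₁ ≠ 0),
      Projectivization.mk ℂ v₀ h₀ = p₀ ∧ Projectivization.mk ℂ v₁ h₁ = p₁ ∧
      herm v₀ v₀ = herm v₁ v₁ ∧ ‖herm z.rep v₀‖ = ‖herm z.rep v₁‖}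

/-- The unitary group `U(n, 1)` of the Hermitian form. -/
def unitaryN1 (n : ℕ) : Subgroup (GL (Fin (n + 1)) ℂ) where
  carrier := {g | ∀ Z W : Fin (n + 1) → ℂ, herm (g.1.mulVec Z) (g.1.mulVec W) = herm Z W}
  one_mem' := by intro Z W; simp
  mul_mem' {g h} hg hh := by
    intro Z W
    have := hg (h.1.mulVec Z) (h.1.mulVec W)
    simpa [Matrix.mulVec_mulVec] using this.trans (hh Z W)
  inv_mem' {g} hg := by
    intro Z W
    have := hg ((g⁻¹).1.mulVec Z) ((g⁻¹).1.mulVec W)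
    rw [Matrix.mulVec_mulVec, Matrix.mulVec_mulVec, ← Units.val_mul, mul_inv_cancel] at this
    simpa using this.symm

/-- The projective unitary group `PU(n, 1)`, as a subgroup of `PGL(n + 1, ℂ)`. -/
def PU (n : ℕ) : Subgroup PGL(Fin (n + 1), ℂ) :=
  (unitaryN1 n).map Matrix.ProjGenLinGroup.mk

/-- The limit set of a subgroup `Γ` of `PU(n, 1)`: the points of the sphere at infinity that are
accumulation points of the orbit `Γ x` of a point `x` of complex hyperbolic space. It does not
depend on the choice of `x`. -/
def limitSet {n : ℕ} (Γ : Subgroup PGL(Fin (n + 1), ℂ)) (x : ℙ ℂ (Fin (n + 1) → ℂ)) :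
    Set (ℙ ℂ (Fin (n + 1) → ℂ)) :=
  sphere n ∩ closure (MulAction.orbit Γ x)

end

end GenHilbert

namespace GenHilbert

/-! For `ω, ω'` in `Ω` put ρ(p) = |⟨ω, p⟩| / |⟨ω', p⟩|. Two distinct isotropic lines are never
orthogonal (`herm_ne_zero_of_linearIndependent`), so ρ is finite and positive on `Λ`, and |[φ_p,
φ_p', ω, ω']| = ρ(p)/ρ(p'). As `Λ` is closed, ρ attains its extrema there, and the distance is
ln(max ρ / min ρ). Symmetry and the triangle inequality follow from the quotient form.

Separation is where bisectors enter. If the distance vanishes, ρ is a constant c, so |⟨p, ω⟩| = |⟨p,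
cω'⟩| on `Λ`. For `ω ≠ ω'` this equation places `Λ` in a bisector (`exists_bisector`,
`exists_subset_bisector`), against the hypothesis. -/

variable {n : ℕ}

/-! ### The Hermitian form and its isotropic vectors -/

lemma herm_add_left (u v w : Fin (n + 1) → ℂ) : herm (u + v) w = herm u w + herm v w :=
  (hermForm w).map_add u v

lemma herm_smul_left (c : ℂ) (u w : Fin (n + 1) → ℂ) : herm (c • u) w = c * herm u w :=
  (hermForm w).map_smul c u

lemma herm_conj_symm (u w : Fin (n + 1) → ℂ) : star (herm u w) = herm w u := by
  unfold herm
  rw [star_sum, ← Equiv.sum_comp (Equiv.swap 0 (Fin.last n))]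
  refine Finset.sum_congr rfl fun i _ => ?_
  simp [mul_comm]

lemma herm_add_right (u v w : Fin (n + 1) → ℂ) : herm u (v + w) = herm u v + herm u w := by
  rw [← herm_conj_symm, herm_add_left, star_add, herm_conj_symm, herm_conj_symm]

lemma herm_smul_right (c : ℂ) (u w : Fin (n + 1) → ℂ) :
    herm u (c • w) = star c * herm u w := by
  rw [← herm_conj_symm, herm_smul_left, star_mul', herm_conj_symm]

lemma norm_herm_comm (u w : Fin (n + 1) → ℂ) : ‖herm u w‖ = ‖herm w u‖ := by
  rw [← herm_conj_symm, norm_star]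

lemma continuous_herm_right (u : Fin (n + 1) → ℂ) : Continuous fun w => herm u w := by
  unfold herm
  fun_prop

lemma continuous_herm_self : Continuous fun w : Fin (n + 1) → ℂ => herm w w := by
  unfold herm
  fun_prop

/-- An isotropic vector whose first coordinate vanishes is a multiple of the last basis vector. -/
lemma apply_eq_zero_of_isotropic {u : Fin (n + 1) → ℂ} (hu : herm u u = 0) (h0 : u 0 = 0)
    {i : Fin (n + 1)} (hi : i ≠ Fin.last n) : u i = 0 := by
  by_cases hi0 : i = 0
  · rw [hi0, h0]
  -- The terms of index `0` and `n` each contain `u 0 = 0`; the others are `‖u j‖ ^ 2`, so each must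
  -- vanish.
  have hsum : ∑ j, (u j * star (u (Equiv.swap 0 (Fin.last n) j))).re = 0 := by
    rw [← Complex.re_sum]
    exact congrArg Complex.re hu
  have hfix : ∀ j, j ≠ 0 → j ≠ Fin.last n →
      (u j * star (u (Equiv.swap 0 (Fin.last n) j))).re = ‖u j‖ ^ 2 := by
    intro j h1 h2
    rw [Equiv.swap_apply_of_ne_of_ne h1 h2, Complex.star_def, Complex.mul_conj']
    norm_cast
  have hnonneg : ∀ j ∈ Finset.univ,
      0 ≤ (u j * star (u (Equiv.swap 0 (Fin.last n) j))).re := by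
    intro j _
    by_cases h1 : j = 0
    · simp [h1, h0]
    by_cases h2 : j = Fin.last n
    · simp [h2, h0]
    rw [hfix j h1 h2]
    positivity
  have := (Finset.sum_eq_zero_iff_of_nonneg hnonneg).1 hsum i (Finset.mem_univ i)
  rw [hfix i hi0 hi] at this
  simpa using this

lemma herm_single_last (a : Fin (n + 1) → ℂ) (c : ℂ) :
    herm a (Pi.single (Fin.last n) c) = a 0 * star c := by
  unfold herm
  rw [Finset.sum_eq_single 0]
  · simp
  · intro j _ hj
    have : Equiv.swap 0 (Fin.last n) j ≠ Fin.last n := by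
      rwa [Ne, ← Equiv.apply_eq_iff_eq (Equiv.swap 0 (Fin.last n)), Equiv.swap_apply_self,
        Equiv.swap_apply_right]
    simp [Pi.single_eq_of_ne this]
  · simp

lemma eq_single_last_of_isotropic {u : Fin (n + 1) → ℂ} (hu : herm u u = 0) (h0 : u 0 = 0) :
    u = Pi.single (Fin.last n) (u (Fin.last n)) := by
  funext i
  by_cases hi : i = Fin.last n
  · subst hi; simp
  · rw [Pi.single_eq_of_ne hi, apply_eq_zero_of_isotropic hu h0 hi]

/-- Linearly independent isotropic vectors are not orthogonal. -/
lemma herm_ne_zero_of_linearIndependent {u w : Fin (n + 1) → ℂ} (hu : herm u u = 0)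
    (hw : herm w w = 0) (hli : LinearIndependent ℂ ![u, w]) : herm u w ≠ 0 := by
  intro huw
  have hwu : herm w u = 0 := by rw [← herm_conj_symm, huw, star_zero]
  rw [LinearIndependent.pair_iff] at hli
  -- If `u ⊥ w`, their span is totally isotropic. The combination `z` kills coordinate `0`, hence is
  -- a multiple of the last basis vector.
  obtain ⟨z, hz⟩ : ∃ z, z = w 0 • u + (-u 0) • w := ⟨_, rfl⟩
  have hzz : herm z z = 0 := by
    simp only [hz, herm_add_left, herm_add_right, herm_smul_left, herm_smul_right, hu, hw, huw, hwu,
      mul_zero, add_zero]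
  have hz0 : z 0 = 0 := by simp [hz]; ring
  have huz : herm u z = 0 := by
    simp only [hz, herm_add_right, herm_smul_right, hu, huw, mul_zero, add_zero]
  have hwz : herm w z = 0 := by
    simp only [hz, herm_add_right, herm_smul_right, hw, hwu, mul_zero, add_zero]
  have hzs := eq_single_last_of_isotropic hzz hz0
  rw [hzs, herm_single_last] at huz hwz
  -- If `z = 0`, independence kills its coefficients `w 0` and `-u 0`; otherwise orthogonality to
  -- `z` does. Then `u` and `w` are both multiples of the last basis vector.
  have h00 : w 0 = 0 ∧ u 0 = 0 := by
    by_cases hc : z (Fin.last n) = 0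
    · rw [hc, Pi.single_zero, hz] at hzs
      have := hli _ _ hzs
      exact ⟨this.1, by simpa using this.2⟩
    · exact ⟨by simpa [hc] using hwz, by simpa [hc] using huz⟩
  have hus := eq_single_last_of_isotropic hu h00.2
  have hws := eq_single_last_of_isotropic hw h00.1
  have h := hli (w (Fin.last n)) (-u (Fin.last n)) (by
    rw [hus, hws, ← Pi.single_smul, ← Pi.single_smul, ← Pi.single_add]
    simp [mul_comm])
  rw [neg_eq_zero] at h
  rw [h.2, Pi.single_zero] at hus
  simpa using hli 1 0 (by simp [hus])

lemma herm_rep_ne_zero {p q : ℙ ℂ (Fin (n + 1) → ℂ)} (hp : p ∈ sphere n) (hq : q ∈ sphere n)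
    (hpq : p ≠ q) : herm p.rep q.rep ≠ 0 :=
  herm_ne_zero_of_linearIndependent hp hq (Projectivization.linearIndependent_pair_iff_ne.2 hpq)

/-! ### Lifts of projective points, and bisectors -/

lemma exists_smul_rep_mk {v : Fin (n + 1) → ℂ} (hv : v ≠ 0) :
    ∃ c : ℂ, c ≠ 0 ∧ (Projectivization.mk ℂ v hv).rep = c • v := by
  obtain ⟨a, ha⟩ := Projectivization.exists_smul_eq_mk_rep ℂ v hv
  exact ⟨a, a.ne_zero, ha.symm⟩

lemma mk_mem_sphere {v : Fin (n + 1) → ℂ} (hv : v ≠ 0) :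
    Projectivization.mk ℂ v hv ∈ sphere n ↔ herm v v = 0 := by
  obtain ⟨c, hc, h⟩ := exists_smul_rep_mk hv
  simp [sphere, h, herm_smul_left, herm_smul_right, hc]

lemma mk_mem_hypSpace {v : Fin (n + 1) → ℂ} (hv : v ≠ 0) :
    Projectivization.mk ℂ v hv ∈ hypSpace n ↔ (herm v v).re < 0 := by
  obtain ⟨c, hc, h⟩ := exists_smul_rep_mk hv
  have : c * (star c * herm v v) = ((‖c‖ ^ 2 : ℝ) : ℂ) * herm v v := by
    rw [← mul_assoc, Complex.star_def, Complex.mul_conj', Complex.ofReal_pow]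
  rw [hypSpace, Set.mem_ofPred_eq, h, herm_smul_left, herm_smul_right, this, Complex.re_ofReal_mul]
  have hpos : 0 < ‖c‖ ^ 2 := by positivity
  constructor
  · intro hneg
    by_contra! h'
    exact absurd hneg (not_lt.2 (mul_nonneg hpos.le h'))
  · exact mul_neg_of_pos_of_neg hpos

/-- For isotropic vectors `a` and `b` with `⟨a, b⟩` negative, the points `z` of the sphere with
`|⟨z, a⟩| = |⟨z, b⟩|` lie in the bisector of `2a + b` and `a + 2b`. -/
lemma exists_bisector {a b : Fin (n + 1) → ℂ} (ha : herm a a = 0) (hb : herm b b = 0) {t : ℝ}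
    (ht : 0 < t) (hab : herm a b = -(t : ℂ)) :
    ∃ p₀ ∈ hypSpace n, ∃ p₁ ∈ hypSpace n, p₀ ≠ p₁ ∧
      ∀ z ∈ sphere n, ‖herm z.rep a‖ = ‖herm z.rep b‖ → z ∈ bisector p₀ p₁ := by
  have hba : herm b a = -(t : ℂ) := by rw [← herm_conj_symm, hab]; simp
  have hexp : ∀ r s : ℂ, herm (r • a + s • b) (r • a + s • b) =
      -(t : ℂ) * (r * star s + s * star r) := by
    intro r s
    simp only [herm_add_left, herm_add_right, herm_smul_left, herm_smul_right, ha, hb, hab, hba]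
    ring
  -- Exchanging `a` and `b` exchanges the two vectors, so they have the same norm, here `-4t < 0`.
  obtain ⟨v₀, hv₀⟩ : ∃ v, v = (2 : ℂ) • a + (1 : ℂ) • b := ⟨_, rfl⟩
  obtain ⟨v₁, hv₁⟩ : ∃ v, v = (1 : ℂ) • a + (2 : ℂ) • b := ⟨_, rfl⟩
  have e₀ : herm v₀ v₀ = ((-(4 * t) : ℝ) : ℂ) := by rw [hv₀, hexp]; simp; ring
  have e₁ : herm v₁ v₁ = ((-(4 * t) : ℝ) : ℂ) := by rw [hv₁, hexp]; simp; ring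
  have e₀₁ : herm v₀ v₁ = ((-(5 * t) : ℝ) : ℂ) := by
    simp only [hv₀, hv₁, herm_add_left, herm_add_right, herm_smul_left, herm_smul_right, ha, hb,
      hab, hba]
    simp
    ring
  have hzero : ∀ v : Fin (n + 1) → ℂ, herm v v = ((-(4 * t) : ℝ) : ℂ) → v ≠ 0 := by
    rintro v hv rfl
    have h0 : herm (0 : Fin (n + 1) → ℂ) 0 = 0 := by simp [herm]
    rw [h0] at hv
    have := Complex.ofReal_eq_zero.1 hv.symm
    linarith
  have hn₀ := hzero v₀ e₀
  have hn₁ := hzero v₁ e₁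
  refine ⟨Projectivization.mk ℂ v₀ hn₀, ?_, Projectivization.mk ℂ v₁ hn₁, ?_, ?_, ?_⟩
  · rw [mk_mem_hypSpace, e₀, Complex.ofReal_re]; linarith
  · rw [mk_mem_hypSpace, e₁, Complex.ofReal_re]; linarith
  · intro h
    -- `v₀ = c v₁` would give both `|c|·4t = 5t` and `|c|·5t = 4t`.
    obtain ⟨c, hc⟩ := (Projectivization.mk_eq_mk_iff' ℂ _ _ hn₀ hn₁).1 h
    have h1 : c * herm v₁ v₁ = herm v₀ v₁ := by rw [← herm_smul_left, hc]
    have h2 : star c * herm v₀ v₁ = herm v₀ v₀ := by rw [← herm_smul_right, hc]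
    rw [e₁, e₀₁] at h1
    rw [e₀, e₀₁] at h2
    have n1 := congrArg norm h1
    have n2 := congrArg norm h2
    rw [norm_mul, Complex.norm_real, Complex.norm_real, norm_neg, norm_neg, Real.norm_of_nonneg
      (by positivity), Real.norm_of_nonneg (by positivity)] at n1
    rw [norm_mul, norm_star, Complex.norm_real, Complex.norm_real, norm_neg, norm_neg,
      Real.norm_of_nonneg (by positivity), Real.norm_of_nonneg (by positivity)] at n2
    nlinarith
  · intro z hz hzab
    refine ⟨Or.inr hz, v₀, v₁, hn₀, hn₁, rfl, rfl, e₀.trans e₁.symm, ?_⟩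
    obtain ⟨x, hx⟩ : ∃ x, x = herm z.rep a := ⟨_, rfl⟩
    obtain ⟨y, hy⟩ : ∃ y, y = herm z.rep b := ⟨_, rfl⟩
    rw [← hx, ← hy] at hzab
    rw [hv₀, hv₁, herm_add_right, herm_add_right]
    simp only [herm_smul_right, ← hx, ← hy]
    have hsq : Complex.normSq x = Complex.normSq y := by
      rw [Complex.normSq_eq_norm_sq, Complex.normSq_eq_norm_sq, hzab]
    rw [Complex.norm_def, Complex.norm_def]
    congr 1
    simp [Complex.normSq_apply] at hsq ⊢
    -- |2x + y|² - |x + 2y|² = 3(|x|² - |y|²), since the cross terms agree.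
    linear_combination 3 * hsq

lemma norm_crossRatio_polar {p p' ω ω' : ℙ ℂ (Fin (n + 1) → ℂ)}
    (h1 : herm ω.rep p.rep ≠ 0) (h2 : herm ω'.rep p.rep ≠ 0)
    (h3 : herm ω.rep p'.rep ≠ 0) (h4 : herm ω'.rep p'.rep ≠ 0) :
    ‖crossRatio (polar p) (polar p') ω ω'‖ =
      (‖herm ω.rep p.rep‖ * ‖herm ω'.rep p'.rep‖) /
        (‖herm ω'.rep p.rep‖ * ‖herm ω.rep p'.rep‖) := by
  rw [← norm_mul, ← norm_mul, ← norm_div]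
  conv_lhs => rw [← ω.mk_rep, ← ω'.mk_rep]
  congr 1
  exact crossRatio_mk _ _ _ _ _ _ _ _ h1 h2 h3 h4

/-! ### Closedness of the limit set and compactness of unit lifts -/

lemma isClosed_preimage_sphere :
    IsClosed (Projectivization.mk' ℂ (V := Fin (n + 1) → ℂ) ⁻¹' sphere n) := by
  have : Projectivization.mk' ℂ (V := Fin (n + 1) → ℂ) ⁻¹' sphere n =
      {v | herm v.1 v.1 = 0} := by
    ext v
    exact mk_mem_sphere v.2
  rw [this]
  exact isClosed_eq (continuous_herm_self.comp continuous_subtype_val) continuous_const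

lemma isClosed_limitSet (Γ : Subgroup PGL(Fin (n + 1), ℂ)) (x : ℙ ℂ (Fin (n + 1) → ℂ)) :
    IsClosed (limitSet Γ x) :=
  (isClosed_coinduced.2 isClosed_preimage_sphere).inter isClosed_closure

/-- The unit lifts of a closed subset of a projective space form a compact set. -/
lemma isCompact_unit_lifts {Λ : Set (ℙ ℂ (Fin (n + 1) → ℂ))} (hΛ : IsClosed Λ) :
    IsCompact {v : Fin (n + 1) → ℂ | ‖v‖ = 1 ∧ ∃ h : v ≠ 0, Projectivization.mk ℂ v h ∈ Λ} := by
  have hS : IsCompact (Metric.sphere (0 : Fin (n + 1) → ℂ) 1) := isCompact_sphere 0 1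
  have hne : ∀ v : Metric.sphere (0 : Fin (n + 1) → ℂ) 1, v.1 ≠ 0 := by
    rintro ⟨v, hv⟩ (rfl : v = 0)
    simp at hv
  have := isCompact_iff_compactSpace.1 hS
  let f : Metric.sphere (0 : Fin (n + 1) → ℂ) 1 → {v : Fin (n + 1) → ℂ // v ≠ 0} :=
    fun v => ⟨v.1, hne v⟩
  have hf : Continuous f := continuous_subtype_val.subtype_mk _
  have hc : IsClosed (f ⁻¹' (Projectivization.mk' ℂ ⁻¹' Λ)) :=
    (isClosed_coinduced.1 hΛ).preimage hf
  convert hc.isCompact.image continuous_subtype_val using 1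
  ext v
  constructor
  · rintro ⟨h1, h2, h3⟩
    exact ⟨⟨v, by simpa using h1⟩, h3, rfl⟩
  · rintro ⟨w, hw, rfl⟩
    exact ⟨by simp, hne w, hw⟩

lemma exists_unit_lift (p : ℙ ℂ (Fin (n + 1) → ℂ)) :
    ∃ v : Fin (n + 1) → ℂ, ‖v‖ = 1 ∧ ∃ h : v ≠ 0, Projectivization.mk ℂ v h = p := by
  have hp : ‖p.rep‖ ≠ 0 := norm_ne_zero_iff.2 p.rep_nonzero
  have hc : ((‖p.rep‖ : ℂ)⁻¹) ≠ 0 := inv_ne_zero (by exact_mod_cast hp)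
  refine ⟨(‖p.rep‖ : ℂ)⁻¹ • p.rep, ?_, smul_ne_zero hc p.rep_nonzero, ?_⟩
  · rw [norm_smul, norm_inv, Complex.norm_real, norm_norm, inv_mul_cancel₀ hp]
  · conv_rhs => rw [← p.mk_rep]
    exact (Projectivization.mk_eq_mk_iff' ℂ _ _ _ _).2 ⟨_, rfl⟩

/-! ### The distance attached to a closed subset of the sphere -/

section ClosedSubsetOfSphere

variable {Λ : Set (ℙ ℂ (Fin (n + 1) → ℂ))} {ω ω' : ℙ ℂ (Fin (n + 1) → ℂ)}

lemma herm_rep_ne_zero_of_mem (hΛ : Λ ⊆ sphere n) (hω : ω ∈ sphere n \ Λ)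
    {p : ℙ ℂ (Fin (n + 1) → ℂ)} (hp : p ∈ Λ) : herm ω.rep p.rep ≠ 0 :=
  herm_rep_ne_zero hω.1 (hΛ hp) fun h => hω.2 (h ▸ hp)

/-- The form ρ(p)/ρ(p') separates the two variables. -/
lemma norm_crossRatio_polar_of_mem (hΛ : Λ ⊆ sphere n) (hω : ω ∈ sphere n \ Λ)
    (hω' : ω' ∈ sphere n \ Λ) {p p' : ℙ ℂ (Fin (n + 1) → ℂ)} (hp : p ∈ Λ) (hp' : p' ∈ Λ) :
    ‖crossRatio (polar p) (polar p') ω ω'‖ =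
      (‖herm ω.rep p.rep‖ / ‖herm ω'.rep p.rep‖) /
        (‖herm ω.rep p'.rep‖ / ‖herm ω'.rep p'.rep‖) := by
  rw [norm_crossRatio_polar (herm_rep_ne_zero_of_mem hΛ hω hp) (herm_rep_ne_zero_of_mem hΛ hω' hp)
    (herm_rep_ne_zero_of_mem hΛ hω hp') (herm_rep_ne_zero_of_mem hΛ hω' hp'), div_div_div_eq]

/-- The ratio does not change when the lift of `q` is rescaled, so it is a continuous function on
the compact set of unit lifts. -/
lemma exists_isMaxOn_ratio (hΛ : Λ ⊆ sphere n) (hcl : IsClosed Λ) (hne : Λ.Nonempty)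
    (hω' : ω' ∈ sphere n \ Λ) :
    ∃ p ∈ Λ, ∀ q ∈ Λ, ‖herm ω.rep q.rep‖ / ‖herm ω'.rep q.rep‖ ≤
      ‖herm ω.rep p.rep‖ / ‖herm ω'.rep p.rep‖ := by
  have hlift : ∀ (v : Fin (n + 1) → ℂ) (h : v ≠ 0),
      ‖herm ω.rep (Projectivization.mk ℂ v h).rep‖ /
        ‖herm ω'.rep (Projectivization.mk ℂ v h).rep‖ =
      ‖herm ω.rep v‖ / ‖herm ω'.rep v‖ := by
    intro v h
    obtain ⟨c, hc, hv⟩ := exists_smul_rep_mk h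
    rw [hv, herm_smul_right, herm_smul_right, norm_mul, norm_mul, norm_star,
      mul_div_mul_left _ _ (norm_ne_zero_iff.2 hc)]
  have hK := isCompact_unit_lifts hcl
  have hKne : {v : Fin (n + 1) → ℂ |
      ‖v‖ = 1 ∧ ∃ h : v ≠ 0, Projectivization.mk ℂ v h ∈ Λ}.Nonempty := by
    obtain ⟨p, hp⟩ := hne
    obtain ⟨v, h1, h2, rfl⟩ := exists_unit_lift p
    exact ⟨v, h1, h2, hp⟩
  obtain ⟨v, ⟨_, hv, hvΛ⟩, hmax⟩ := hK.exists_isMaxOn hKne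
    (f := fun v => ‖herm ω.rep v‖ / ‖herm ω'.rep v‖) (by
      refine ContinuousOn.div (continuous_herm_right _).norm.continuousOn
        (continuous_herm_right _).norm.continuousOn ?_
      rintro v ⟨_, hv, hvΛ⟩
      obtain ⟨c, hc, h⟩ := exists_smul_rep_mk hv
      have := herm_rep_ne_zero_of_mem hΛ hω' hvΛ
      rw [h, herm_smul_right] at this
      exact norm_ne_zero_iff.2 (right_ne_zero_of_mul this))
  refine ⟨_, hvΛ, fun q hq => ?_⟩
  obtain ⟨w, h1, h2, rfl⟩ := exists_unit_lift q
  rw [hlift, hlift]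
  exact hmax ⟨h1, h2, hq⟩

lemma exists_isGreatest_crossRatioModuli (hΛ : Λ ⊆ sphere n) (hcl : IsClosed Λ)
    (hne : Λ.Nonempty) (hω : ω ∈ sphere n \ Λ) (hω' : ω' ∈ sphere n \ Λ) :
    ∃ r : ℝ, IsGreatest (crossRatioModuli (polar '' Λ) ω ω') r := by
  obtain ⟨p, hp, hmax⟩ := exists_isMaxOn_ratio (ω := ω) hΛ hcl hne hω'
  -- With `ω` and `ω'` exchanged, the maximum is that of 1/ρ.
  obtain ⟨p', hp', hmax'⟩ := exists_isMaxOn_ratio (ω := ω') hΛ hcl hne hω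
  refine ⟨_, ⟨_, ⟨p, hp, rfl⟩, _, ⟨p', hp', rfl⟩, rfl⟩, ?_⟩
  rintro _ ⟨_, ⟨q, hq, rfl⟩, _, ⟨q', hq', rfl⟩, rfl⟩
  rw [norm_crossRatio_polar_of_mem hΛ hω hω' hp hp', norm_crossRatio_polar_of_mem hΛ hω hω' hq hq',
    div_eq_mul_inv, div_eq_mul_inv (_ / _), inv_div, inv_div]
  exact mul_le_mul (hmax q hq) (hmax' q' hq') (by positivity) (by positivity)

/-- Exchanging `ω, ω'` inverts ρ, which exchanging the two hyperplanes undoes. -/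
lemma crossRatioModuli_comm (hΛ : Λ ⊆ sphere n) (hω : ω ∈ sphere n \ Λ)
    (hω' : ω' ∈ sphere n \ Λ) :
    crossRatioModuli (polar '' Λ) ω ω' ⊆ crossRatioModuli (polar '' Λ) ω' ω := by
  rintro _ ⟨_, ⟨q, hq, rfl⟩, _, ⟨q', hq', rfl⟩, rfl⟩
  refine ⟨_, ⟨q', hq', rfl⟩, _, ⟨q, hq, rfl⟩, ?_⟩
  rw [norm_crossRatio_polar_of_mem hΛ hω hω' hq hq', norm_crossRatio_polar_of_mem hΛ hω' hω hq' hq,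
    div_div_div_eq, div_div_div_eq, mul_comm, mul_comm ‖herm ω'.rep q.rep‖]

/-- Taken at equal hyperplanes. It makes every maximum at least `1`, so that its logarithm is well
behaved. -/
lemma one_mem_crossRatioModuli (hΛ : Λ ⊆ sphere n) (hne : Λ.Nonempty) (hω : ω ∈ sphere n \ Λ)
    (hω' : ω' ∈ sphere n \ Λ) : 1 ∈ crossRatioModuli (polar '' Λ) ω ω' := by
  obtain ⟨p, hp⟩ := hne
  refine ⟨_, ⟨p, hp, rfl⟩, _, ⟨p, hp, rfl⟩, ?_⟩
  have h1 := norm_ne_zero_iff.2 (herm_rep_ne_zero_of_mem hΛ hω hp)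
  have h2 := norm_ne_zero_iff.2 (herm_rep_ne_zero_of_mem hΛ hω' hp)
  rw [norm_crossRatio_polar_of_mem hΛ hω hω' hp hp, div_self (div_ne_zero h1 h2)]

/-- If the moduli of all the cross-ratios are at most `1` for some distinct `ω` and `ω'`, then `Λ`
is contained in a bisector. -/
lemma exists_subset_bisector (hΛ : Λ ⊆ sphere n) (hne : Λ.Nonempty) (hω : ω ∈ sphere n \ Λ)
    (hω' : ω' ∈ sphere n \ Λ) (hωω' : ω ≠ ω')
    (hle : ∀ r ∈ crossRatioModuli (polar '' Λ) ω ω', r ≤ 1) :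
    ∃ p₀ ∈ hypSpace n, ∃ p₁ ∈ hypSpace n, p₀ ≠ p₁ ∧ Λ ⊆ bisector p₀ p₁ := by
  have hpos : ∀ p ∈ Λ, 0 < ‖herm ω.rep p.rep‖ / ‖herm ω'.rep p.rep‖ := fun p hp =>
    div_pos (norm_pos_iff.2 (herm_rep_ne_zero_of_mem hΛ hω hp))
      (norm_pos_iff.2 (herm_rep_ne_zero_of_mem hΛ hω' hp))
  -- All quotients ρ(p)/ρ(q) being at most `1`, in both orders, ρ is constant.
  have hmono : ∀ p ∈ Λ, ∀ q ∈ Λ, ‖herm ω.rep p.rep‖ / ‖herm ω'.rep p.rep‖ ≤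
      ‖herm ω.rep q.rep‖ / ‖herm ω'.rep q.rep‖ := by
    intro p hp q hq
    have := hle _ ⟨_, ⟨p, hp, rfl⟩, _, ⟨q, hq, rfl⟩, rfl⟩
    rwa [norm_crossRatio_polar_of_mem hΛ hω hω' hp hq, div_le_one (hpos q hq)] at this
  obtain ⟨p, hp⟩ := hne
  obtain ⟨c, hc⟩ : ∃ c, c = ‖herm ω.rep p.rep‖ / ‖herm ω'.rep p.rep‖ := ⟨_, rfl⟩
  have hc0 : 0 < c := hc ▸ hpos p hp
  have ht : herm ω.rep ω'.rep ≠ 0 := herm_rep_ne_zero hω.1 hω'.1 hωω'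
  obtain ⟨t, htdef⟩ : ∃ t, t = herm ω.rep ω'.rep := ⟨_, rfl⟩
  rw [← htdef] at ht
  have htn : (‖t‖ : ℂ) ≠ 0 := by exact_mod_cast norm_ne_zero_iff.2 ht
  have hω1 : herm ω.rep ω.rep = 0 := hω.1
  have hω2 : herm ω'.rep ω'.rep = 0 := hω'.1
  -- The phase of the scalar makes `⟨a, b⟩ = -c‖t‖` negative; its modulus `c` makes `|⟨q, a⟩| = |⟨q,
  -- b⟩|` on `Λ`.
  obtain ⟨p₀, h₀, p₁, h₁, hne, hsub⟩ := exists_bisector (a := ω.rep)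
    (b := (-(c : ℂ) * (t / ‖t‖)) • ω'.rep) (t := c * ‖t‖) hω1
    (by rw [herm_smul_left, herm_smul_right, hω2]; ring) (by positivity) (by
      have : t * star t = (‖t‖ : ℂ) ^ 2 := by rw [Complex.star_def, Complex.mul_conj']
      have hs : star (-(c : ℂ) * (t / ‖t‖)) = -(c : ℂ) * (star t / ‖t‖) := by simp
      rw [herm_smul_right, ← htdef, hs]
      push_cast
      field_simp
      linear_combination -(c : ℂ) * this)
  refine ⟨p₀, h₀, p₁, h₁, hne, fun q hq => hsub q (hΛ hq) ?_⟩
  have hq' : ‖herm ω'.rep q.rep‖ ≠ 0 := norm_ne_zero_iff.2 (herm_rep_ne_zero_of_mem hΛ hω' hq)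
  have hcq : ‖herm ω.rep q.rep‖ / ‖herm ω'.rep q.rep‖ = c :=
    hc ▸ le_antisymm (hmono q hq p hp) (hmono p hp q hq)
  rw [div_eq_iff hq'] at hcq
  have hct : ‖-(c : ℂ) * (t / ‖t‖)‖ = c := by
    rw [norm_mul, norm_neg, Complex.norm_real, Real.norm_of_nonneg hc0.le, norm_div,
      Complex.norm_real, norm_norm, div_self (norm_ne_zero_iff.2 ht), mul_one]
  rw [herm_smul_right, norm_mul, norm_star, hct, norm_herm_comm, hcq, norm_herm_comm q.rep]

/-- For fixed hyperplanes the modulus is multiplicative along `ω, ω', ω''`; it suffices to bound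
each factor at a pair attaining the maximum for `ω, ω''`. -/
lemma hilbertDist_triangle (hΛ : Λ ⊆ sphere n) (hcl : IsClosed Λ) (hne : Λ.Nonempty)
    {ω'' : ℙ ℂ (Fin (n + 1) → ℂ)} (hω : ω ∈ sphere n \ Λ) (hω' : ω' ∈ sphere n \ Λ)
    (hω'' : ω'' ∈ sphere n \ Λ) :
    hilbertDist (polar '' Λ) ω ω'' ≤
      hilbertDist (polar '' Λ) ω ω' + hilbertDist (polar '' Λ) ω' ω'' := by
  obtain ⟨r, hr⟩ := exists_isGreatest_crossRatioModuli hΛ hcl hne hω hω''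
  obtain ⟨s, hs⟩ := exists_isGreatest_crossRatioModuli hΛ hcl hne hω hω'
  obtain ⟨t, ht⟩ := exists_isGreatest_crossRatioModuli hΛ hcl hne hω' hω''
  have hr1 := hr.2 (one_mem_crossRatioModuli hΛ hne hω hω'')
  have hs1 := hs.2 (one_mem_crossRatioModuli hΛ hne hω hω')
  have ht1 := ht.2 (one_mem_crossRatioModuli hΛ hne hω' hω'')
  unfold hilbertDist
  rw [hr.csSup_eq, hs.csSup_eq, ht.csSup_eq, ← Real.log_mul (by positivity) (by positivity)]
  refine Real.log_le_log (by positivity) ?_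
  obtain ⟨_, ⟨p, hp, rfl⟩, _, ⟨q, hq, rfl⟩, rfl⟩ := hr.1
  refine le_trans (le_of_eq ?_) (mul_le_mul (hs.2 ⟨_, ⟨p, hp, rfl⟩, _, ⟨q, hq, rfl⟩, rfl⟩)
    (ht.2 ⟨_, ⟨p, hp, rfl⟩, _, ⟨q, hq, rfl⟩, rfl⟩) (norm_nonneg _) (by positivity))
  rw [norm_crossRatio_polar_of_mem hΛ hω hω'' hp hq, norm_crossRatio_polar_of_mem hΛ hω hω' hp hq,
    norm_crossRatio_polar_of_mem hΛ hω' hω'' hp hq]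
  have h1 := norm_ne_zero_iff.2 (herm_rep_ne_zero_of_mem hΛ hω' hp)
  have h2 := norm_ne_zero_iff.2 (herm_rep_ne_zero_of_mem hΛ hω' hq)
  field_simp

lemma eq_of_hilbertDist_eq_zero (hΛ : Λ ⊆ sphere n) (hcl : IsClosed Λ) (hne : Λ.Nonempty)
    (hbis : ∀ p₀ ∈ hypSpace n, ∀ p₁ ∈ hypSpace n, p₀ ≠ p₁ → ¬ Λ ⊆ bisector p₀ p₁)
    (hω : ω ∈ sphere n \ Λ) (hω' : ω' ∈ sphere n \ Λ)
    (h : hilbertDist (polar '' Λ) ω ω' = 0) : ω = ω' := by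
  by_contra hωω'
  obtain ⟨r, hr⟩ := exists_isGreatest_crossRatioModuli hΛ hcl hne hω hω'
  have hr1 := hr.2 (one_mem_crossRatioModuli hΛ hne hω hω')
  unfold hilbertDist at h
  rw [hr.csSup_eq] at h
  -- `r ≥ 1` rules out the other zeros `0` and `-1` of `Real.log`.
  have hr2 : r = 1 := Real.eq_one_of_pos_of_log_eq_zero (by positivity) h
  obtain ⟨p₀, h₀, p₁, h₁, h₀₁, hsub⟩ := exists_subset_bisector hΛ hne hω hω' hωω'
    fun s hs => hr2 ▸ hr.2 hs
  exact hbis p₀ h₀ p₁ h₁ h₀₁ hsub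

end ClosedSubsetOfSphere

/-! ### Degenerate cases and conclusion -/

lemma hilbertDist_self (Λ : Set (ℙ ℂ (Dual ℂ (Fin (n + 1) → ℂ)))) (ω : ℙ ℂ (Fin (n + 1) → ℂ)) :
    hilbertDist Λ ω ω = 0 := by
  have hsub : crossRatioModuli Λ ω ω ⊆ {1} := by
    rintro _ ⟨φ, _, φ', _, rfl⟩
    simp [crossRatio]
  unfold hilbertDist
  -- For empty `Λ` the value is still `0`, because `sSup ∅ = 0` and `Real.log 0 = 0`.
  rcases Set.subset_singleton_iff_eq.1 hsub with h | h <;> simp [h]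

/-- Ensures that at least one bisector exists, so that the hypothesis of the theorem excludes an
empty limit set. -/
lemma exists_ne_mem_hypSpace (hn : 1 ≤ n) : ∃ p₀ ∈ hypSpace n, ∃ p₁ ∈ hypSpace n, p₀ ≠ p₁ := by
  have h0 : (Fin.last n) ≠ 0 := by
    intro h
    have := congrArg Fin.val h
    simp at this
    omega
  have ha : herm (Pi.single 0 1 : Fin (n + 1) → ℂ) (Pi.single 0 1) = 0 := by
    unfold herm
    rw [Finset.sum_eq_single 0 (by intro j _ hj; simp [Pi.single_eq_of_ne hj]) (by simp)]
    simp [Pi.single_eq_of_ne h0]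
  -- For `n ≥ 1`, the first basis vector and minus the last are isotropic with product `-1`.
  obtain ⟨p₀, h₀, p₁, h₁, hne, _⟩ := exists_bisector (n := n) (a := Pi.single 0 1)
    (b := Pi.single (Fin.last n) (-1)) (t := 1) ha
    (by rw [herm_single_last, Pi.single_eq_of_ne h0.symm, zero_mul]) one_pos
    (by rw [herm_single_last]; simp)
  exact ⟨p₀, h₀, p₁, h₁, hne⟩

end GenHilbert

open GenHilbert in
theorem mainTheorem12 (n : ℕ) (hn : 1 ≤ n)
    (Γ : Subgroup PGL(Fin (n + 1), ℂ)) (hΓ : Γ ≤ GenHilbert.PU n) (hdisc : DiscreteTopology Γ)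
    (x : ℙ ℂ (Fin (n + 1) → ℂ)) (hx : x ∈ GenHilbert.hypSpace n)
    (Λ : Set (ℙ ℂ (Fin (n + 1) → ℂ))) (hΛ : Λ = GenHilbert.limitSet Γ x)
    (Ω : Set (ℙ ℂ (Fin (n + 1) → ℂ))) (hΩ : Ω = GenHilbert.sphere n \ Λ)
    (hbis : ∀ p₀ ∈ GenHilbert.hypSpace n, ∀ p₁ ∈ GenHilbert.hypSpace n, p₀ ≠ p₁ →
      ¬ Λ ⊆ GenHilbert.bisector p₀ p₁) :
    (∀ ω ∈ Ω, ∀ ω' ∈ Ω, ∃ r : ℝ,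
      IsGreatest (GenHilbert.crossRatioModuli (GenHilbert.polar '' Λ) ω ω') r) ∧
    ∃ m : MetricSpace Ω, ∀ ω ω' : Ω,
      m.dist ω ω' = GenHilbert.hilbertDist (GenHilbert.polar '' Λ) ω ω' := by
  have hsub : Λ ⊆ sphere n := by rw [hΛ]; exact Set.inter_subset_left
  have hcl : IsClosed Λ := by rw [hΛ]; exact isClosed_limitSet Γ x
  -- An empty `Λ` would lie in any bisector.
  have hne : Λ.Nonempty := by
    by_contra h
    rw [Set.not_nonempty_iff_eq_empty] at h
    obtain ⟨p₀, h₀, p₁, h₁, h₀₁⟩ := exists_ne_mem_hypSpace hn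
    exact hbis p₀ h₀ p₁ h₁ h₀₁ (h ▸ Set.empty_subset _)
  subst hΩ
  refine ⟨fun ω hω ω' hω' => exists_isGreatest_crossRatioModuli hsub hcl hne hω hω', ?_⟩
  refine ⟨{ dist := fun ω ω' => hilbertDist (polar '' Λ) ω ω'
            dist_self := fun ω => hilbertDist_self _ _
            dist_comm := fun ω ω' => congrArg (fun s => Real.log (sSup s))
              (Set.Subset.antisymm (crossRatioModuli_comm hsub ω.2 ω'.2)
                (crossRatioModuli_comm hsub ω'.2 ω.2))
            dist_triangle := fun ω ω' ω'' => hilbertDist_triangle hsub hcl hne ω.2 ω'.2 ω''.2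
            eq_of_dist_eq_zero := fun {ω ω'} h => Subtype.ext
              (eq_of_hilbertDist_eq_zero hsub hcl hne hbis ω.2 ω'.2 h) },
    fun _ _ => rfl⟩
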